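/- Write $|\cdot|$ and $\langle\cdot,\cdot\rangle$ for the Euclidean norm and inner product, $S^{n-1}$ for the Euclidean unit sphere of $\mathbb{R}^n$, and $\|Y\|_{\psi_2}=\inf\{u>0:\mathbb{E}\exp(Y^2/u^2)\le 2\}$ for a random variable $Y$. For $m\ge 0$ let $U_m=\{x\in S^{n-1}: |\{i: x_i\neq 0\}|\le m\}$. There exist absolute constants $c>1$ and $C,\bar c>0$ for which the following holds. Let $1\le k\le n$ be integers, let $\alpha\ge 1$, and let $\mu$ be a probability measure on $\mathbb{R}^n$ that is isotropic and $\psi_2$ with constant $\alpha$, i.e. if $X$ has law $\mu$ then for every $y\in\mathbb{R}^n$ $$\mathbb{E}\,|\langle X,y\rangle|^2=|y|^2\qquad\text{and}\qquad \|\langle X,y\rangle\|_{\psi_2}\le\alpha\,|y|.$$ Let $X_1,\dots,X_k$ be independent random vectors with law $\mu$, and let $\Gamma=\sum_{i=1}^k\langle X_i,\cdot\rangle e_i:\mathbb{R}^n\to\mathbb{R}^k$, where $(e_i)$ is the standard basis of $\mathbb{R}^k$. Then for every $0<\theta<1$ and every integer $m\ge 0$ with $$m\le C\,\frac{\theta^2k/\alpha^4}{\log\bigl(c\,n\,\alpha^4/(\theta^2k)\bigr)},$$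 with probability at least $1-\exp(-\bar c\,\theta^2k/\alpha^4)$, every $x\in 2\operatorname{conv}(U_{4m})\cap S^{n-1}$ satisfies $$(1-\theta)\,|x|^2\le\frac{|\Gamma x|^2}{k}\le(1+\theta)\,|x|^2 .$$ -/

import Mathlib

open MeasureTheory ProbabilityTheory
open scoped ENNReal NNReal Pointwise

noncomputable section

/-- The norm `‖Y‖_{ψ₂} = inf {u > 0 : 𝔼 exp (Y² / u²) ≤ 2}` of a random variable `Y`, with values in
`[0, ∞]` (it is `∞` if no such `u` exists). -/
def psiTwoNorm {Ω : Type*} [MeasurableSpace Ω] (P : Measure Ω) (Y : Ω → ℝ) : ℝ≥0∞ :=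
  ⨅ (u : ℝ≥0) (_ : 0 < u)
    (_ : ∫⁻ ω, ENNReal.ofReal (Real.exp (Y ω ^ 2 / (u : ℝ) ^ 2)) ∂P ≤ 2), (u : ℝ≥0∞)

/-- `μ` is isotropic: `𝔼 |⟨X, y⟩|² = |y|²` for every `y`, where `X` has law `μ`. -/
def IsIsotropic {n : ℕ} (μ : Measure (EuclideanSpace ℝ (Fin n))) : Prop :=
  ∀ y : EuclideanSpace ℝ (Fin n),
    Integrable (fun x => |inner ℝ x y| ^ 2) μ ∧ ∫ x, |inner ℝ x y| ^ 2 ∂μ = ‖y‖ ^ 2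

/-- `μ` satisfies a `ψ₂` condition with constant `α`: `‖⟨X, y⟩‖_{ψ₂} ≤ α |y|` for every `y`, where
`X` has law `μ`. -/
def SatisfiesPsiTwo {n : ℕ} (μ : Measure (EuclideanSpace ℝ (Fin n))) (α : ℝ) : Prop :=
  ∀ y : EuclideanSpace ℝ (Fin n),
    psiTwoNorm μ (fun x => inner ℝ x y) ≤ ENNReal.ofReal (α * ‖y‖)

/-- The operator `∑ i, ⟨X i, ·⟩ e_i` from `ℝⁿ` to `ℝᵏ` with rows `X i`. -/
def rowOperator {n k : ℕ} (X : Fin k → EuclideanSpace ℝ (Fin n)) :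
    EuclideanSpace ℝ (Fin n) →L[ℝ] EuclideanSpace ℝ (Fin k) :=
  ∑ i, (innerSL ℝ (X i)).smulRight (EuclideanSpace.single i (1 : ℝ))

/-- The unit vectors of `ℝⁿ` with at most `m` nonzero coordinates. -/
def sparseUnit (n m : ℕ) : Set (EuclideanSpace ℝ (Fin n)) :=
  {x | x ∈ Metric.sphere (0 : EuclideanSpace ℝ (Fin n)) 1 ∧ {i : Fin n | x i ≠ 0}.ncard ≤ m}

end

/-! The quadratic form `|Γx|² - k|x|²` comes from the symmetric bilinear form `B(u, v) = ∑ ⟨X_i,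
u⟩⟨X_i, v⟩ - k⟨u, v⟩`. For fixed `u, v` of norm at most 2, isotropy makes `B(u, v)` a centred sum,
and its summands, products of two ψ₂ variables, are subexponential at scale `α²`. Bernstein then
gives a tail `2 exp(-c k t²/α⁴)` for `|B(u, v)| ≥ kt`.

Vectors in the convex hull need not be sparse, but `B` is linear in each argument. A finite set that
norms every coordinate subspace of dimension at most `4m` therefore controls linear functionals on
the whole hull, and using it once per argument controls `B(y, y)`. The set has about `exp(C m
log(1/l))` points, and the condition on `m` makes a union bound over pairs affordable. -/

/-! ### Bernstein's inequality for subexponential variables -/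

theorem exp_le_one_add_add_sq_mul_exp_abs (x : ℝ) :
    Real.exp x ≤ 1 + x + x ^ 2 * Real.exp |x| := by
  have h := Complex.norm_exp_sub_sum_le_norm_mul_exp (x : ℂ) 2
  have e : Complex.exp (x : ℂ) - ∑ m ∈ Finset.range 2, (x : ℂ) ^ m / (m.factorial : ℂ)
      = ((Real.exp x - (1 + x) : ℝ) : ℂ) := by
    simp [Finset.sum_range_succ]
  rw [e, Complex.norm_real, Complex.norm_real, Real.norm_eq_abs, Real.norm_eq_abs, sq_abs] at h
  linarith [(abs_le.1 h).2]

theorem sq_le_eight_mul_exp_half {z : ℝ} (hz : 0 ≤ z) : z ^ 2 ≤ 8 * Real.exp (z / 2) := by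
  have := Real.quadratic_le_exp_of_nonneg (x := z / 2) (by positivity)
  nlinarith

theorem exp_mul_le_of_abs_le {K l y : ℝ} (hK : 0 < K) (hl : |l| ≤ 1 / (2 * K)) :
    Real.exp (l * y) ≤ 1 + l * y + 8 * l ^ 2 * K ^ 2 * Real.exp (|y| / K) := by
  refine (exp_le_one_add_add_sq_mul_exp_abs (l * y)).trans ?_
  have h1 : |l * y| ≤ |y| / K / 2 := by
    rw [abs_mul]
    calc |l| * |y| ≤ 1 / (2 * K) * |y| := by gcongr
      _ = |y| / K / 2 := by field_simp
  have h2 := sq_le_eight_mul_exp_half (z := |y| / K) (by positivity)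
  have h3 : Real.exp (|y| / K) = Real.exp (|y| / K / 2) * Real.exp (|y| / K / 2) := by
    rw [← Real.exp_add]; ring_nf
  have h4 : (l * y) ^ 2 = l ^ 2 * K ^ 2 * (|y| / K) ^ 2 := by
    rw [div_pow, sq_abs]; field_simp
  have : (l * y) ^ 2 * Real.exp |l * y| ≤ 8 * l ^ 2 * K ^ 2 * Real.exp (|y| / K) := by
    calc (l * y) ^ 2 * Real.exp |l * y|
        ≤ l ^ 2 * K ^ 2 * (8 * Real.exp (|y| / K / 2)) * Real.exp (|y| / K / 2) := by
          rw [h4]; gcongr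
      _ = _ := by rw [h3]; ring
  linarith

section Bernstein

variable {Ω : Type*} [MeasurableSpace Ω] {P : Measure Ω}

theorem integrable_exp_mul_of_integrable_exp_abs_div {Y : Ω → ℝ} {K l : ℝ}
    (hY : AEMeasurable Y P) (hint : Integrable (fun ω => Real.exp (|Y ω| / K)) P)
    (hl : |l| ≤ 1 / K) : Integrable (fun ω => Real.exp (l * Y ω)) P := by
  refine hint.mono' (by fun_prop) (ae_of_all _ fun ω => ?_)
  rw [Real.norm_eq_abs, Real.abs_exp]
  apply Real.exp_le_exp.2
  calc l * Y ω ≤ |l| * |Y ω| := by rw [← abs_mul]; exact le_abs_self _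
    _ ≤ 1 / K * |Y ω| := by gcongr
    _ = |Y ω| / K := by ring

variable [IsProbabilityMeasure P]

theorem mgf_le_of_integral_exp_abs_div_le_two {Y : Ω → ℝ} {K l : ℝ} (hK : 0 < K)
    (hY : AEMeasurable Y P) (hint : Integrable (fun ω => Real.exp (|Y ω| / K)) P)
    (hexp : ∫ ω, Real.exp (|Y ω| / K) ∂P ≤ 2) (hl : |l| ≤ 1 / (2 * K)) :
    mgf Y P l ≤ Real.exp (l * (∫ ω, Y ω ∂P) + 16 * l ^ 2 * K ^ 2) := by
  have hYint : Integrable Y P := by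
    refine (hint.const_mul K).mono' hY.aestronglyMeasurable (ae_of_all _ fun ω => ?_)
    have := Real.add_one_le_exp (|Y ω| / K)
    rw [Real.norm_eq_abs]
    calc |Y ω| = K * (|Y ω| / K) := by field_simp
      _ ≤ K * Real.exp (|Y ω| / K) := by gcongr; linarith
  have hl' : |l| ≤ 1 / K := hl.trans (by gcongr; linarith)
  have h1 : Integrable (fun ω => 1 + l * Y ω) P := (integrable_const _).add (hYint.const_mul l)
  have h2 : Integrable (fun ω => 8 * l ^ 2 * K ^ 2 * Real.exp (|Y ω| / K)) P := hint.const_mul _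
  calc mgf Y P l
      ≤ ∫ ω, (1 + l * Y ω + 8 * l ^ 2 * K ^ 2 * Real.exp (|Y ω| / K)) ∂P :=
        integral_mono (integrable_exp_mul_of_integrable_exp_abs_div hY hint hl')
          (h1.add h2) fun ω => exp_mul_le_of_abs_le hK hl
    _ = 1 + l * (∫ ω, Y ω ∂P) + 8 * l ^ 2 * K ^ 2 * ∫ ω, Real.exp (|Y ω| / K) ∂P := by
        rw [integral_add h1 h2, integral_add (integrable_const _) (hYint.const_mul l),
          integral_const_mul, integral_const_mul]
        simp
    _ ≤ l * (∫ ω, Y ω ∂P) + 16 * l ^ 2 * K ^ 2 + 1 := by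
        have : 8 * l ^ 2 * K ^ 2 * ∫ ω, Real.exp (|Y ω| / K) ∂P ≤ 8 * l ^ 2 * K ^ 2 * 2 := by
          gcongr
        linarith
    _ ≤ _ := Real.add_one_le_exp _

theorem measureReal_sum_ge_le_of_integral_exp_abs_div_le_two {k : ℕ} {Y : Fin k → Ω → ℝ}
    {K b t : ℝ} (hK : 0 < K) (hY : ∀ i, AEMeasurable (Y i) P) (hindep : iIndepFun Y P)
    (hint : ∀ i, Integrable (fun ω => Real.exp (|Y i ω| / K)) P)
    (hexp : ∀ i, ∫ ω, Real.exp (|Y i ω| / K) ∂P ≤ 2)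
    (hb : ∀ i, ∫ ω, Y i ω ∂P = b) (ht : 0 ≤ t) (htK : t ≤ 16 * K) :
    P.real {ω | k * b + k * t ≤ ∑ i, Y i ω} ≤ Real.exp (-(k * t ^ 2 / (64 * K ^ 2))) := by
  -- This minimises `-l t + 16 l² K²`, with value `-t²/(64 K²)`; `t ≤ 16 K` is exactly `l ≤ 1/(2K)`.
  set l : ℝ := t / (32 * K ^ 2) with hl
  have hl0 : 0 ≤ l := by positivity
  have hl1 : |l| ≤ 1 / (2 * K) := by
    rw [abs_of_nonneg hl0, hl, div_le_div_iff₀ (by positivity) (by positivity)]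
    nlinarith
  have hl2 : |l| ≤ 1 / K := hl1.trans (by gcongr; linarith)
  have hprod : mgf (∑ i, Y i) P l = ∏ i, mgf (Y i) P l := hindep.mgf_sum₀ hY Finset.univ
  have hpos : 0 < mgf (∑ i, Y i) P l := by
    rw [hprod]
    exact Finset.prod_pos fun i _ =>
      mgf_pos (integrable_exp_mul_of_integrable_exp_abs_div (hY i) (hint i) hl2)
  -- `mgf` defaults to 0 when the exponential is not integrable, so positivity forces integrability.
  have hsum : Integrable (fun ω => Real.exp (l * (∑ i, Y i) ω)) P := by
    by_contra h
    exact hpos.ne' (mgf_undef h)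
  have hmgf : mgf (∑ i, Y i) P l ≤ Real.exp (l * b + 16 * l ^ 2 * K ^ 2) ^ k := by
    rw [hprod]
    calc ∏ i, mgf (Y i) P l ≤ ∏ _i : Fin k, Real.exp (l * b + 16 * l ^ 2 * K ^ 2) :=
          Finset.prod_le_prod (fun i _ => mgf_nonneg) fun i _ => by
            simpa [hb i] using
              mgf_le_of_integral_exp_abs_div_le_two hK (hY i) (hint i) (hexp i) hl1
      _ = _ := by simp
  have := measure_ge_le_exp_mul_mgf (X := ∑ i, Y i) (k * b + k * t) hl0 hsum
  simp only [Finset.sum_apply] at this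
  refine this.trans ((mul_le_mul_of_nonneg_left hmgf (Real.exp_pos _).le).trans_eq ?_)
  rw [← Real.exp_nat_mul, ← Real.exp_add, hl]
  congr 1
  field_simp
  ring

theorem measureReal_abs_sum_sub_ge_le_of_integral_exp_abs_div_le_two {k : ℕ}
    {Y : Fin k → Ω → ℝ} {K b t : ℝ} (hK : 0 < K) (hY : ∀ i, AEMeasurable (Y i) P)
    (hindep : iIndepFun Y P) (hint : ∀ i, Integrable (fun ω => Real.exp (|Y i ω| / K)) P)
    (hexp : ∀ i, ∫ ω, Real.exp (|Y i ω| / K) ∂P ≤ 2)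
    (hb : ∀ i, ∫ ω, Y i ω ∂P = b) (ht : 0 ≤ t) (htK : t ≤ 16 * K) :
    P.real {ω | k * t ≤ |∑ i, Y i ω - k * b|} ≤
      2 * Real.exp (-(k * t ^ 2 / (64 * K ^ 2))) := by
  have h1 := measureReal_sum_ge_le_of_integral_exp_abs_div_le_two hK hY hindep hint hexp hb ht htK
  have h2 := measureReal_sum_ge_le_of_integral_exp_abs_div_le_two (P := P) (Y := fun i ω => -Y i ω)
    (K := K) (b := -b) hK (fun i => (hY i).neg)
    (hindep.comp (fun _ x => -x) fun _ => measurable_neg)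
    (by simpa using hint) (by simpa using hexp) (fun i => by rw [integral_neg, hb i]) ht htK
  rw [two_mul]
  refine (measureReal_mono ?_).trans ((measureReal_union_le _ _).trans (add_le_add h1 h2))
  intro ω hω
  simp only [Set.mem_ofPred_eq, Set.mem_union, Finset.sum_neg_distrib] at hω ⊢
  rcases le_abs.1 hω with h | h
  · left; linarith
  · right; linarith

end Bernstein

/-! ### Finite norming sets for sparse vectors -/

/-- A maximal 1-separated subset of the ball of radius 2 is a 1-net there. Approximating `2x`, with
`x` a unit vector, gives `2‖f‖ ≤ S + ‖f‖`. -/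
theorem exists_finset_two_ball_norming (V : Type*) [NormedAddCommGroup V] [InnerProductSpace ℝ V]
    [FiniteDimensional ℝ V] :
    ∃ N : Finset V, N.card ≤ 5 ^ Module.finrank ℝ V ∧ (∀ u ∈ N, ‖u‖ ≤ 2) ∧
      ∀ (f : V →L[ℝ] ℝ) (S : ℝ), (∀ u ∈ N, |f u| ≤ S) → ‖f‖ ≤ S := by
  classical
  set p : ℕ → Prop := fun j => ∃ N : Finset V, N.card = j ∧ (∀ u ∈ N, ‖u‖ ≤ 2) ∧
    ∀ c ∈ N, ∀ d ∈ N, c ≠ d → 1 ≤ ‖c - d‖ with hp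
  have h0 : p 0 := ⟨∅, by simp⟩
  have hbd : ∀ j, p j → j ≤ 5 ^ Module.finrank ℝ V := by
    rintro j ⟨N, rfl, h1, h2⟩
    exact Besicovitch.card_le_of_separated N h1 h2
  obtain ⟨N, hNc, hN2, hNsep⟩ : p (Nat.findGreatest p (5 ^ Module.finrank ℝ V)) :=
    Nat.findGreatest_spec (Nat.zero_le _) h0
  have hnet : ∀ x : V, ‖x‖ ≤ 2 → ∃ u ∈ N, ‖x - u‖ ≤ 1 := by
    intro x hx
    by_contra! h
    have hxN : x ∉ N := fun hxN => by have := h x hxN; simp at this; linarith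
    have hq : p (N.card + 1) := by
      refine ⟨insert x N, Finset.card_insert_of_notMem hxN, ?_, ?_⟩
      · intro u hu
        rcases Finset.mem_insert.1 hu with rfl | hu
        exacts [hx, hN2 u hu]
      · intro c hc d hd hcd
        rcases Finset.mem_insert.1 hc with hcx | hcN <;>
          rcases Finset.mem_insert.1 hd with hdx | hdN
        · exact absurd (hcx.trans hdx.symm) hcd
        · rw [hcx]; exact (h d hdN).le
        · rw [hdx, norm_sub_rev]; exact (h c hcN).le
        · exact hNsep c hcN d hdN hcd
    have := Nat.le_findGreatest (hbd _ hq) hq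
    omega
  refine ⟨N, hNc ▸ Nat.findGreatest_le _, hN2, fun f S hS => ?_⟩
  obtain ⟨u₀, hu₀, -⟩ := hnet 0 (by simp)
  have hS0 : 0 ≤ S := (abs_nonneg _).trans (hS u₀ hu₀)
  have key : ‖f‖ ≤ (S + ‖f‖) / 2 := by
    refine f.opNorm_le_of_unit_norm (by positivity) fun x hx => ?_
    obtain ⟨u, hu, hxu⟩ := hnet ((2 : ℝ) • x) (by rw [norm_smul, hx]; norm_num)
    have h1 : |f ((2 : ℝ) • x)| ≤ S + ‖f‖ := by
      have e : f ((2 : ℝ) • x) = f u + f ((2 : ℝ) • x - u) := by rw [← map_add]; congr 1; abel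
      rw [e]
      refine (abs_add_le _ _).trans (add_le_add (hS u hu) ?_)
      exact (f.le_opNorm _).trans (mul_le_of_le_one_right (norm_nonneg _) hxu)
    rw [map_smul, smul_eq_mul, abs_mul, abs_two] at h1
    rw [Real.norm_eq_abs]
    linarith
  linarith

/-- Give each subset `I` the weight `l ^ |I|`: the total is `(1 + l)ⁿ ≤ exp(nl)`, and each small
subset weighs at least `l ^ s`. -/
theorem card_filter_card_le_le_exp {n s : ℕ} {l : ℝ} (hl : 0 < l) (hl1 : l ≤ 1) :
    (((Finset.univ : Finset (Finset (Fin n))).filter (fun I => I.card ≤ s)).card : ℝ) ≤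
      Real.exp (n * l + s * Real.log (1 / l)) := by
  have h1 : (((Finset.univ : Finset (Finset (Fin n))).filter (fun I => I.card ≤ s)).card : ℝ) * l ^ s
      ≤ (l + 1) ^ n := by
    rw [← Fin.sum_pow_mul_eq_add_pow, ← nsmul_eq_mul, ← Finset.sum_const]
    simp only [one_pow, mul_one]
    refine (Finset.sum_le_sum fun I hI => ?_).trans
      (Finset.sum_le_sum_of_subset_of_nonneg (Finset.subset_univ _) fun I _ _ => by positivity)
    exact pow_le_pow_of_le_one hl.le hl1 (Finset.mem_filter.1 hI).2
  have h2 : (l + 1) ^ n ≤ Real.exp (n * l) := by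
    rw [Real.exp_nat_mul]
    gcongr
    exact Real.add_one_le_exp l
  have h3 : Real.exp (s * Real.log (1 / l)) * l ^ s = 1 := by
    rw [Real.exp_nat_mul, Real.exp_log (by positivity), ← mul_pow]
    simp [hl.ne']
  have hls : 0 < l ^ s := by positivity
  refine le_of_mul_le_mul_right ?_ hls
  rw [Real.exp_add, mul_assoc, h3, mul_one]
  exact h1.trans h2

theorem exists_finset_norming_sparseUnit (n s : ℕ) {l : ℝ} (hl : 0 < l) (hl1 : l ≤ 1) :
    ∃ N : Finset (EuclideanSpace ℝ (Fin n)),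
      (N.card : ℝ) ≤ Real.exp (n * l + s * Real.log (1 / l)) * 5 ^ s ∧ (∀ u ∈ N, ‖u‖ ≤ 2) ∧
      ∀ (w : EuclideanSpace ℝ (Fin n)) (S : ℝ), (∀ u ∈ N, |inner ℝ w u| ≤ S) →
        ∀ x ∈ convexHull ℝ (sparseUnit n s), |inner ℝ w x| ≤ S := by
  classical
  let V : Finset (Fin n) → Submodule ℝ (EuclideanSpace ℝ (Fin n)) := fun I =>
    Submodule.span ℝ ((I.image fun i => EuclideanSpace.single i (1 : ℝ) : Finset _) : Set _)
  choose M hMc hM2 hM using fun I => exists_finset_two_ball_norming (V I)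
  let A := (Finset.univ : Finset (Finset (Fin n))).filter (fun I => I.card ≤ s)
  refine ⟨A.biUnion fun I => (M I).image Subtype.val, ?_, ?_, ?_⟩
  · have hcard : (A.biUnion fun I => (M I).image Subtype.val).card ≤ A.card * 5 ^ s := by
      refine Finset.card_biUnion_le_card_mul _ _ _ fun I hI => ?_
      refine Finset.card_image_le.trans ((hMc I).trans (Nat.pow_le_pow_right (by norm_num) ?_))
      exact ((finrank_span_finset_le_card _).trans Finset.card_image_le).trans
        (Finset.mem_filter.1 hI).2
    calc ((A.biUnion fun I => (M I).image Subtype.val).card : ℝ) ≤ A.card * 5 ^ s := by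
          exact_mod_cast hcard
      _ ≤ _ := by gcongr; exact card_filter_card_le_le_exp hl hl1
  · intro u hu
    obtain ⟨I, -, hu⟩ := Finset.mem_biUnion.1 hu
    obtain ⟨v, hv, rfl⟩ := Finset.mem_image.1 hu
    exact hM2 I v hv
  · intro w S hS
    -- The preimage of an interval under a linear functional is convex, so a bound on sparse unit
    -- vectors passes to their hull.
    have hsparse : sparseUnit n s ⊆ (innerSL ℝ w) ⁻¹' Set.Icc (-S) S := by
      rintro x ⟨hx1, hxs⟩
      have hx1 : ‖x‖ = 1 := by simpa using hx1
      let I : Finset (Fin n) := Finset.univ.filter fun i => x i ≠ 0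
      have hIA : I ∈ A := by
        refine Finset.mem_filter.2 ⟨Finset.mem_univ _, ?_⟩
        rw [← Set.ncard_coe_finset]
        simpa [I] using hxs
      have hxV : x ∈ V I := by
        have e : x = ∑ i ∈ I, x i • EuclideanSpace.single i (1 : ℝ) := by
          ext j
          simp [I, Finset.sum_apply, Pi.single_apply, Finset.sum_ite_eq]
        rw [e]
        refine Submodule.sum_mem _ fun i hi => Submodule.smul_mem _ _ (Submodule.subset_span ?_)
        exact Finset.mem_coe.2 (Finset.mem_image_of_mem _ hi)
      have hf := hM I ((innerSL ℝ w).comp (V I).subtypeL) S fun u hu => by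
        simpa using hS u (Finset.mem_biUnion.2 ⟨I, hIA, Finset.mem_image_of_mem _ hu⟩)
      have := ((innerSL ℝ w).comp (V I).subtypeL).le_of_opNorm_le hf ⟨x, hxV⟩
      rw [Submodule.coe_norm, hx1, mul_one, Real.norm_eq_abs] at this
      exact abs_le.1 this
    intro x hx
    have := convexHull_min hsparse
      ((convex_Icc (-S) S).linear_preimage (innerSL ℝ w).toLinearMap) hx
    exact abs_le.2 this

/-! ### Moments and concentration of products of marginals -/

theorem exp_abs_mul_div_le (a b : ℝ) {K : ℝ} (hK : 0 < K) :
    Real.exp (|a * b| / K) ≤ (Real.exp (a ^ 2 / K) + Real.exp (b ^ 2 / K)) / 2 := by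
  have h1 : |a * b| / K ≤ a ^ 2 / K / 2 + b ^ 2 / K / 2 := by
    rw [← add_div, ← add_div, div_right_comm]
    gcongr
    rw [abs_mul]
    nlinarith [sq_nonneg (|a| - |b|), sq_abs a, sq_abs b]
  have h2 : ∀ z : ℝ, Real.exp z = Real.exp (z / 2) ^ 2 := fun z => by
    rw [← Real.exp_nat_mul]; ring_nf
  calc Real.exp (|a * b| / K) ≤ Real.exp (a ^ 2 / K / 2) * Real.exp (b ^ 2 / K / 2) := by
        rw [← Real.exp_add]; exact Real.exp_le_exp.2 h1
    _ ≤ _ := by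
        rw [h2 (a ^ 2 / K), h2 (b ^ 2 / K)]
        nlinarith [sq_nonneg (Real.exp (a ^ 2 / K / 2) - Real.exp (b ^ 2 / K / 2))]

section Moments

variable {n : ℕ} {μ : Measure (EuclideanSpace ℝ (Fin n))} {α : ℝ}

theorem SatisfiesPsiTwo.integrable_exp_sq_inner (hμ : SatisfiesPsiTwo μ α) (hα : 1 ≤ α)
    {u : EuclideanSpace ℝ (Fin n)} (hu : ‖u‖ ≤ 2) :
    Integrable (fun x => Real.exp (inner ℝ x u ^ 2 / (9 * α ^ 2))) μ ∧
      ∫ x, Real.exp (inner ℝ x u ^ 2 / (9 * α ^ 2)) ∂μ ≤ 2 := by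
  -- The norm is at most `2α`; the slack up to `3α` yields an admissible `r` without showing that
  -- the infimum is attained.
  have hlt : psiTwoNorm μ (fun x => inner ℝ x u) < ENNReal.ofReal (3 * α) :=
    (hμ u).trans_lt ((ENNReal.ofReal_lt_ofReal_iff (by linarith)).2 (by nlinarith))
  simp only [psiTwoNorm, iInf_lt_iff] at hlt
  obtain ⟨r, hr, hle, hrα⟩ := hlt
  have hr' : (r : ℝ) ≤ 3 * α := by
    have := ENNReal.toReal_mono ENNReal.ofReal_ne_top hrα.le
    rwa [ENNReal.coe_toReal, ENNReal.toReal_ofReal (by linarith)] at this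
  have hr0 : (0 : ℝ) < r := hr
  have hle' : ∫⁻ x, ENNReal.ofReal (Real.exp (inner ℝ x u ^ 2 / (9 * α ^ 2))) ∂μ ≤ 2 := by
    refine (lintegral_mono fun x => ENNReal.ofReal_le_ofReal (Real.exp_le_exp.2 ?_)).trans hle
    gcongr
    nlinarith
  have hmeas : AEStronglyMeasurable
      (fun x : EuclideanSpace ℝ (Fin n) => Real.exp (inner ℝ x u ^ 2 / (9 * α ^ 2))) μ :=
    (by fun_prop : Continuous fun x : EuclideanSpace ℝ (Fin n) =>
      Real.exp (inner ℝ x u ^ 2 / (9 * α ^ 2))).aestronglyMeasurable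
  have hnn : 0 ≤ᵐ[μ] fun x : EuclideanSpace ℝ (Fin n) =>
      Real.exp (inner ℝ x u ^ 2 / (9 * α ^ 2)) := ae_of_all _ fun x => (Real.exp_pos _).le
  refine ⟨⟨hmeas, (hasFiniteIntegral_iff_ofReal hnn).2 (hle'.trans_lt (by simp))⟩, ?_⟩
  rw [integral_eq_lintegral_of_nonneg_ae hnn hmeas]
  exact ENNReal.toReal_le_of_le_ofReal (by norm_num) (by simpa using hle')

theorem SatisfiesPsiTwo.integrable_exp_abs_inner_mul_inner (hμ : SatisfiesPsiTwo μ α)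
    (hα : 1 ≤ α) {u v : EuclideanSpace ℝ (Fin n)} (hu : ‖u‖ ≤ 2) (hv : ‖v‖ ≤ 2) :
    Integrable (fun x => Real.exp (|inner ℝ x u * inner ℝ x v| / (9 * α ^ 2))) μ ∧
      ∫ x, Real.exp (|inner ℝ x u * inner ℝ x v| / (9 * α ^ 2)) ∂μ ≤ 2 := by
  obtain ⟨hu1, hu2⟩ := hμ.integrable_exp_sq_inner hα hu
  obtain ⟨hv1, hv2⟩ := hμ.integrable_exp_sq_inner hα hv
  have hle := fun x : EuclideanSpace ℝ (Fin n) =>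
    exp_abs_mul_div_le (inner ℝ x u) (inner ℝ x v) (K := 9 * α ^ 2) (by positivity)
  have hdom := (hu1.add hv1).div_const 2
  have hint : Integrable
      (fun x => Real.exp (|inner ℝ x u * inner ℝ x v| / (9 * α ^ 2))) μ := by
    refine hdom.mono' (Continuous.aestronglyMeasurable (by fun_prop)) (ae_of_all _ fun x => ?_)
    rw [Real.norm_eq_abs, Real.abs_exp]
    exact hle x
  refine ⟨hint, (integral_mono hint hdom hle).trans ?_⟩
  simp only [Pi.add_apply]
  rw [integral_div, integral_add hu1 hv1]
  linarith

theorem IsIsotropic.integral_inner_mul_inner (hμ : IsIsotropic μ)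
    (u v : EuclideanSpace ℝ (Fin n)) :
    ∫ x, inner ℝ x u * inner ℝ x v ∂μ = inner ℝ u v := by
  obtain ⟨h1, h2⟩ := hμ (u + v)
  obtain ⟨h3, h4⟩ := hμ (u - v)
  have e : (fun x : EuclideanSpace ℝ (Fin n) => inner ℝ x u * inner ℝ x v) =
      fun x => (|inner ℝ x (u + v)| ^ 2 - |inner ℝ x (u - v)| ^ 2) / 4 := by
    ext x
    rw [sq_abs, sq_abs, inner_add_right, inner_sub_right]
    ring
  rw [e, integral_div, integral_sub h1 h3, h2, h4, norm_add_sq_real, norm_sub_sq_real]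
  ring

theorem measureReal_abs_sum_inner_mul_inner_sub_ge_le [IsProbabilityMeasure μ]
    (hiso : IsIsotropic μ) (hpsi : SatisfiesPsiTwo μ α) (hα : 1 ≤ α) {k : ℕ}
    {Ω : Type*} [MeasurableSpace Ω] {P : Measure Ω} [IsProbabilityMeasure P]
    {X : Fin k → Ω → EuclideanSpace ℝ (Fin n)} (hX : ∀ i, HasLaw (X i) μ P)
    (hindep : iIndepFun X P) {u v : EuclideanSpace ℝ (Fin n)} (hu : ‖u‖ ≤ 2) (hv : ‖v‖ ≤ 2)
    {t : ℝ} (ht : 0 ≤ t) (ht1 : t ≤ 1) :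
    P.real {ω | k * t ≤ |∑ i, inner ℝ (X i ω) u * inner ℝ (X i ω) v - k * inner ℝ u v|} ≤
      2 * Real.exp (-(k * t ^ 2 / (5184 * α ^ 4))) := by
  have hg : Measurable fun x : EuclideanSpace ℝ (Fin n) => inner ℝ x u * inner ℝ x v :=
    Continuous.measurable (by fun_prop)
  have hg' : Measurable fun x : EuclideanSpace ℝ (Fin n) =>
      Real.exp (|inner ℝ x u * inner ℝ x v| / (9 * α ^ 2)) :=
    Continuous.measurable (by fun_prop)
  obtain ⟨h1, h2⟩ := hpsi.integrable_exp_abs_inner_mul_inner hα hu hv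
  have := measureReal_abs_sum_sub_ge_le_of_integral_exp_abs_div_le_two (P := P)
    (Y := fun i ω => inner ℝ (X i ω) u * inner ℝ (X i ω) v) (K := 9 * α ^ 2)
    (b := inner ℝ u v) (t := t) (by positivity)
    (fun i => hg.comp_aemeasurable (hX i).aemeasurable)
    (hindep.comp _ fun _ => hg)
    (fun i => by
      have h := h1
      rw [← (hX i).map_eq] at h
      exact h.comp_aemeasurable (hX i).aemeasurable)
    (fun i => ((hX i).integral_comp hg'.aestronglyMeasurable).trans_le h2)
    (fun i => ((hX i).integral_comp hg.aestronglyMeasurable).trans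
      (hiso.integral_inner_mul_inner u v)) ht (by nlinarith)
  convert this using 4
  ring

end Moments

/-! ### From the norming set to the dilated convex hull -/

theorem norm_sq_rowOperator_apply {n k : ℕ} (X : Fin k → EuclideanSpace ℝ (Fin n))
    (x : EuclideanSpace ℝ (Fin n)) : ‖rowOperator X x‖ ^ 2 = ∑ i, inner ℝ (X i) x ^ 2 := by
  rw [EuclideanSpace.real_norm_sq_eq]
  refine Finset.sum_congr rfl fun j _ => ?_
  simp [rowOperator, Pi.single_apply, Finset.sum_ite_eq]

/-- `T` is self-adjoint, so the norming property applies to one argument of `⟨Tu, v⟩` and then to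
the other. The factor 4 is the square of the dilation. -/
theorem abs_norm_sq_rowOperator_sub_le_of_norming {n k s : ℕ}
    {N : Finset (EuclideanSpace ℝ (Fin n))}
    (hN : ∀ (w : EuclideanSpace ℝ (Fin n)) (S : ℝ), (∀ u ∈ N, |inner ℝ w u| ≤ S) →
      ∀ x ∈ convexHull ℝ (sparseUnit n s), |inner ℝ w x| ≤ S)
    (X : Fin k → EuclideanSpace ℝ (Fin n)) {S : ℝ}
    (hS : ∀ u ∈ N, ∀ v ∈ N, |∑ i, inner ℝ (X i) u * inner ℝ (X i) v - k * inner ℝ u v| ≤ S)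
    {x : EuclideanSpace ℝ (Fin n)} (hx : x ∈ (2 : ℝ) • convexHull ℝ (sparseUnit n s)) :
    |‖rowOperator X x‖ ^ 2 - k * ‖x‖ ^ 2| ≤ 4 * S := by
  let T : EuclideanSpace ℝ (Fin n) → EuclideanSpace ℝ (Fin n) := fun u =>
    ∑ i, inner ℝ (X i) u • X i - (k : ℝ) • u
  have hT : ∀ u v, inner ℝ (T u) v =
      ∑ i, inner ℝ (X i) u * inner ℝ (X i) v - k * inner ℝ u v := fun u v => by
    simp [T, inner_sub_left, sum_inner, inner_smul_left]
  have hsymm : ∀ u v, inner ℝ (T u) v = inner ℝ (T v) u := fun u v => by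
    rw [hT, hT, real_inner_comm v u]
    simp only [mul_comm]
  obtain ⟨y, hy, rfl⟩ := hx
  have hyy : |inner ℝ (T y) y| ≤ S := by
    refine hN _ _ (fun u hu => ?_) y hy
    rw [hsymm]
    refine hN _ _ (fun v hv => ?_) y hy
    rw [hT]
    exact hS u hu v hv
  rw [hT, real_inner_self_eq_norm_sq] at hyy
  have e : ‖rowOperator X ((2 : ℝ) • y)‖ ^ 2 - k * ‖(2 : ℝ) • y‖ ^ 2 =
      4 * (∑ i, inner ℝ (X i) y * inner ℝ (X i) y - k * ‖y‖ ^ 2) := by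
    rw [map_smul, norm_smul, norm_smul, mul_pow, mul_pow, norm_sq_rowOperator_apply]
    simp only [pow_two]
    norm_num
    ring
  beta_reduce
  rw [e, abs_mul, abs_of_pos (by norm_num : (0 : ℝ) < 4)]
  gcongr

/-! ### Union bound and conclusion -/

theorem five_pow_le_exp (j : ℕ) : (5 : ℝ) ^ j ≤ Real.exp (2 * j) := by
  rw [mul_comm, Real.exp_nat_mul]
  gcongr
  have h1 := Real.exp_one_gt_d9
  have h2 : Real.exp 2 = Real.exp 1 * Real.exp 1 := by rw [← Real.exp_add]; norm_num
  nlinarith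

theorem measureReal_exists_two_smul_convexHull_deviation_le {n k : ℕ} (hk : 1 ≤ k) (hkn : k ≤ n) {α : ℝ}
    (hα : 1 ≤ α) {μ : Measure (EuclideanSpace ℝ (Fin n))} [IsProbabilityMeasure μ]
    (hiso : IsIsotropic μ) (hpsi : SatisfiesPsiTwo μ α)
    {Ω : Type*} [MeasurableSpace Ω] {P : Measure Ω} [IsProbabilityMeasure P]
    {X : Fin k → Ω → EuclideanSpace ℝ (Fin n)} (hX : ∀ i, HasLaw (X i) μ P)
    (hindep : iIndepFun X P) {θ : ℝ} (hθ : 0 < θ) (hθ1 : θ < 1) {m : ℕ} (hm : 1 ≤ m)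
    (hmk : (m : ℝ) ≤ 10⁻¹ ^ 7 *
      ((θ ^ 2 * k / α ^ 4) / Real.log (10 ^ 6 * n * α ^ 4 / (θ ^ 2 * k)))) :
    P.real {ω | ∃ x ∈ (2 : ℝ) • convexHull ℝ (sparseUnit n (4 * m)),
        θ * k < |‖rowOperator (fun i => X i ω) x‖ ^ 2 - k * ‖x‖ ^ 2|} ≤
      Real.exp (-(6 * 10⁻¹ ^ 6 * θ ^ 2 * k / α ^ 4)) := by
  have hk0 : (0 : ℝ) < k := by exact_mod_cast hk
  have hkn' : (k : ℝ) ≤ n := by exact_mod_cast hkn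
  have hn0 : (0 : ℝ) < n := hk0.trans_le hkn'
  have hm1 : (1 : ℝ) ≤ m := by exact_mod_cast hm
  have hα4 : 1 ≤ α ^ 4 := one_le_pow₀ hα
  set D : ℝ := θ ^ 2 * k / α ^ 4 with hD
  have hD0 : 0 < D := by positivity
  have hDn : D ≤ n := by
    rw [hD, div_le_iff₀ (by positivity)]
    have : θ ^ 2 ≤ 1 := by nlinarith
    nlinarith
  have hDl : (10 : ℝ) ^ 6 * n * α ^ 4 / (θ ^ 2 * k) = 1 / (D / (10 ^ 6 * n)) := by
    rw [hD]; field_simp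
  rw [hDl] at hmk
  set l : ℝ := D / (10 ^ 6 * n) with hl
  set L : ℝ := Real.log (1 / l) with hL
  have hl0 : 0 < l := by positivity
  have hl1 : l ≤ 10⁻¹ ^ 6 := by
    rw [hl, div_le_iff₀ (by positivity)]
    linarith
  have hL1 : 1 ≤ L := by
    rw [hL, Real.le_log_iff_exp_le (by positivity), le_div_iff₀ hl0]
    have := Real.exp_one_lt_d9
    nlinarith [Real.exp_pos 1]
  have hmL : m * L ≤ 10⁻¹ ^ 7 * D := by
    rwa [← mul_div_assoc, le_div_iff₀ (by linarith)] at hmk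
  obtain ⟨N, hNc, hN2, hN⟩ :=
    exists_finset_norming_sparseUnit n (4 * m) hl0 (hl1.trans (by norm_num))
  -- The 12 collects `4mL` from the choice of support and `8m ≤ 8mL` from `5 ^ (4m)`.
  have hNc' : (N.card : ℝ) ≤ Real.exp (10⁻¹ ^ 6 * D + 12 * (10⁻¹ ^ 7 * D)) := by
    refine hNc.trans ((mul_le_mul_of_nonneg_left (five_pow_le_exp _) (Real.exp_pos _).le).trans ?_)
    rw [← Real.exp_add, Real.exp_le_exp]
    have : n * l = 10⁻¹ ^ 6 * D := by rw [hl]; field_simp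
    rw [this, ← hL]
    push_cast
    nlinarith
  have hpair : ∀ q ∈ N ×ˢ N,
      P.real {ω | k * (θ / 4) ≤
        |∑ i, inner ℝ (X i ω) q.1 * inner ℝ (X i ω) q.2 - k * inner ℝ q.1 q.2|} ≤
      2 * Real.exp (-(D / 82944)) := fun q hq => by
    obtain ⟨h1, h2⟩ := Finset.mem_product.1 hq
    refine (measureReal_abs_sum_inner_mul_inner_sub_ge_le hiso hpsi hα hX hindep (hN2 _ h1)
      (hN2 _ h2) (by positivity) (by linarith)).trans_eq ?_
    congr 3
    rw [hD]
    field_simp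
    norm_num
  have hsub : {ω | ∃ x ∈ (2 : ℝ) • convexHull ℝ (sparseUnit n (4 * m)),
        θ * k < |‖rowOperator (fun i => X i ω) x‖ ^ 2 - k * ‖x‖ ^ 2|} ⊆
      ⋃ q ∈ N ×ˢ N, {ω | k * (θ / 4) ≤
        |∑ i, inner ℝ (X i ω) q.1 * inner ℝ (X i ω) q.2 - k * inner ℝ q.1 q.2|} := by
    rintro ω ⟨x, hx, hlt⟩
    by_contra hω
    simp only [Set.mem_iUnion, not_exists, Set.mem_ofPred_eq, not_le] at hω
    have := abs_norm_sq_rowOperator_sub_le_of_norming hN (fun i => X i ω) (S := k * (θ / 4))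
      (fun u hu v hv => (hω (u, v) (Finset.mk_mem_product hu hv)).le) hx
    linarith
  -- Since `m ≥ 1` and `L ≥ 1`, `hmL` gives `10⁻⁷ D ≥ 1`; this is where `m ≠ 0` matters.
  have h2 : (2 : ℝ) ≤ Real.exp (10⁻¹ ^ 7 * D) := by
    have := Real.add_one_le_exp (10⁻¹ ^ 7 * D)
    nlinarith
  calc _ ≤ ∑ q ∈ N ×ˢ N, P.real {ω | k * (θ / 4) ≤
        |∑ i, inner ℝ (X i ω) q.1 * inner ℝ (X i ω) q.2 - k * inner ℝ q.1 q.2|} :=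
        (measureReal_mono hsub (measure_ne_top _ _)).trans (measureReal_biUnion_finset_le _ _)
    _ ≤ N.card * N.card * (2 * Real.exp (-(D / 82944))) := by
        refine (Finset.sum_le_card_nsmul _ _ _ hpair).trans_eq ?_
        rw [Finset.card_product, nsmul_eq_mul, Nat.cast_mul]
    _ ≤ Real.exp (10⁻¹ ^ 6 * D + 12 * (10⁻¹ ^ 7 * D)) *
          Real.exp (10⁻¹ ^ 6 * D + 12 * (10⁻¹ ^ 7 * D)) *
          (Real.exp (10⁻¹ ^ 7 * D) * Real.exp (-(D / 82944))) := by gcongr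
    -- The cost is `2 · 2.2 · 10⁻⁶ + 10⁻⁷ = 4.5 · 10⁻⁶` against a gain `1/82944 > 12 · 10⁻⁶`.
    _ ≤ _ := by
        rw [← Real.exp_add, ← Real.exp_add, ← Real.exp_add, Real.exp_le_exp]
        have : 6 * 10⁻¹ ^ 6 * θ ^ 2 * k / α ^ 4 = 6 * 10⁻¹ ^ 6 * D := by rw [hD]; ring
        rw [this]
        linarith

theorem mainTheorem10 :
    ∃ c C cbar : ℝ, 1 < c ∧ 0 < C ∧ 0 < cbar ∧
      ∀ (n k : ℕ), 1 ≤ k → k ≤ n →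
      ∀ (α : ℝ), 1 ≤ α →
      ∀ (μ : Measure (EuclideanSpace ℝ (Fin n))) [IsProbabilityMeasure μ],
        IsIsotropic μ → SatisfiesPsiTwo μ α →
      ∀ (Ω : Type*) [MeasurableSpace Ω] (P : Measure Ω) [IsProbabilityMeasure P]
        (X : Fin k → Ω → EuclideanSpace ℝ (Fin n)),
        (∀ i, HasLaw (X i) μ P) → iIndepFun X P →
      ∀ (θ : ℝ), 0 < θ → θ < 1 →
      ∀ (m : ℕ),
        (m : ℝ) ≤ C * ((θ ^ 2 * k / α ^ 4) / Real.log (c * n * α ^ 4 / (θ ^ 2 * k))) →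
        ENNReal.ofReal (1 - Real.exp (-(cbar * θ ^ 2 * k / α ^ 4))) ≤
          P {ω | ∀ x ∈ ((2 : ℝ) • convexHull ℝ (sparseUnit n (4 * m))) ∩
                Metric.sphere (0 : EuclideanSpace ℝ (Fin n)) 1,
              (1 - θ) * ‖x‖ ^ 2 ≤ ‖rowOperator (fun i => X i ω) x‖ ^ 2 / k ∧
              ‖rowOperator (fun i => X i ω) x‖ ^ 2 / k ≤ (1 + θ) * ‖x‖ ^ 2} := by
  refine ⟨10 ^ 6, 10⁻¹ ^ 7, 6 * 10⁻¹ ^ 6, by norm_num, by norm_num, by norm_num, ?_⟩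
  intro n k hk hkn α hα μ _ hiso hpsi Ω _ P _ X hX hindep θ hθ hθ1 m hm
  have hk0 : (0 : ℝ) < k := by exact_mod_cast hk
  rcases Nat.eq_zero_or_pos m with rfl | hm0
  · have hempty : sparseUnit n (4 * 0) = ∅ := by
      refine Set.eq_empty_of_forall_notMem fun x hx => ?_
      obtain ⟨hx1, hx0⟩ := hx
      have hzero : x = 0 := by
        ext i
        have h := (Set.ncard_eq_zero (Set.toFinite _)).1 (Nat.le_zero.1 hx0)
        by_contra hi
        exact (h ▸ (show i ∈ {i | x i ≠ 0} from hi) : i ∈ (∅ : Set (Fin n)))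
      simp [hzero] at hx1
    simp only [hempty, convexHull_empty, Set.smul_set_empty, Set.empty_inter,
      Set.mem_empty_iff_false, false_imp_iff, implies_true, Set.ofPred_true, measure_univ]
    exact ENNReal.ofReal_le_one.2 (sub_le_self _ (Real.exp_pos _).le)
  · have hbad := measureReal_exists_two_smul_convexHull_deviation_le hk hkn hα hiso hpsi hX
      hindep hθ hθ1 hm0 hm
    set B := {ω | ∃ x ∈ (2 : ℝ) • convexHull ℝ (sparseUnit n (4 * m)),
      θ * k < |‖rowOperator (fun i => X i ω) x‖ ^ 2 - k * ‖x‖ ^ 2|}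
    -- Subadditivity suffices, so measurability of `B` is not needed.
    have hone : (1 : ℝ) ≤ P.real Bᶜ + P.real B := by
      rw [← probReal_univ (μ := P), ← Set.compl_union_self B]
      exact measureReal_union_le _ _
    have hgood : 1 - Real.exp (-(6 * 10⁻¹ ^ 6 * θ ^ 2 * k / α ^ 4)) ≤ P.real Bᶜ := by linarith
    refine (ENNReal.ofReal_le_ofReal hgood).trans ?_
    rw [ofReal_measureReal]
    refine measure_mono fun ω hω x hx => ?_
    have hx1 : ‖x‖ = 1 := by simpa using hx.2
    have hle : |‖rowOperator (fun i => X i ω) x‖ ^ 2 - k * ‖x‖ ^ 2| ≤ θ * k := by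
      by_contra h
      exact hω ⟨x, hx.1, not_le.1 h⟩
    rw [hx1, one_pow, mul_one] at hle
    rw [hx1, one_pow, mul_one, mul_one, le_div_iff₀ hk0, div_le_iff₀ hk0]
    obtain ⟨h1, h2⟩ := abs_le.1 hle
    constructor <;> linarith
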